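/- Let $\zeta$ be the Riemann zeta function and let $Z(t)=e^{i\vartheta(t)}\zeta(\tfrac12+it)$ be Hardy's (real-valued) function, where $\vartheta(t)=\operatorname{Im}\log\Gamma(\tfrac14+\tfrac{it}{2})-\tfrac t2\log\pi$ is the Riemann--Siegel theta function (continuous branch with $\vartheta(0)=0$). Let $\gamma$ run over the ordinates (imaginary parts), positive and negative, of all zeros of $\zeta$ in the critical strip $0<\operatorname{Re}s<1$, each taken according to the multiplicity of the zero. Assume the Riemann Hypothesis. Then there are absolute constants $C,T>0$ such that, for every real $t\ge T$ with $\zeta(\tfrac12+it)\neq0$ (that is, $t$ is not one of the $\gamma$), $Z$ is twice differentiable at $t$, the series $\sum_\gamma (t-\gamma)^{-2}$ converges, and $$\left|\sum_\gamma\frac1{(t-\gamma)^2}+\frac{d}{dt}\left\{\frac{Z'(t)}{Z(t)}\right\}\right|\le\frac Ct ,$$ or, equivalently, $$\left|\sum_\gamma\frac1{(t-\gamma)^2}-\left(\left\{\frac{Z'(t)}{Z(t)}\right\}^2-\frac{Z''(t)}{Z(t)}\right)\right|\le\frac Ct .$$ That is, $\sum_\gamma (t-\gamma)^{-2}=-\frac{d}{dt}\{Z'(t)/Z(t)\}+O(1/t)=\{Z'(t)/Z(t)\}^2-Z''(t)/Z(t)+O(1/t)$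 as $t\to\infty$, uniformly in $t$ outside the set of ordinates. -/

import Mathlib

open Complex Set
open scoped Real

noncomputable section

/-- The zeros of the Riemann zeta function in the critical strip `0 < Re s < 1`
(the nontrivial zeros). -/
def nontrivialZetaZeros : Set ℂ :=
  {ρ | riemannZeta ρ = 0 ∧ 0 < ρ.re ∧ ρ.re < 1}

/-- The summand `1 / (t - γ)²` attached to the zero `ρ` with ordinate `γ = Im ρ`,
taken as many times as the multiplicity of `ρ` as a zero of `ζ`. -/
def zeroTerm (t : ℝ) (ρ : nontrivialZetaZeros) : ℝ :=
  (analyticOrderNatAt riemannZeta (ρ : ℂ) : ℝ) * (1 / (t - (ρ : ℂ).im) ^ 2)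

/-- The Riemann–Siegel theta function
`ϑ(t) = Im log Γ(1/4 + it/2) - (t/2) log π`. The logarithm is the branch that varies continuously
along the line `Re s = 1/4` and is real at `s = 1/4`: its imaginary part vanishes at `t = 0`
and has derivative `Re ψ(1/4 + it/2) / 2`, where `ψ = Γ'/Γ`. -/
def siegelTheta (t : ℝ) : ℝ :=
  (∫ u in (0 : ℝ)..t, (digamma (1 / 4 + I * u / 2)).re / 2) - t / 2 * Real.log π

/-- Hardy's function `Z(t) = e^{iϑ(t)} ζ(1/2 + it)`. The right-hand side is real
(see `riemannZeta_eq_exp_mul_hardyZ`), so that taking the real part only changes the type. -/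
def hardyZ (t : ℝ) : ℝ :=
  (exp (I * siegelTheta t) * riemannZeta (1 / 2 + I * t)).re

theorem quarterLine_ne (u : ℝ) (m : ℕ) : (1 / 4 + I * u / 2 : ℂ) ≠ -m := by
  intro h
  have := congrArg Complex.re h
  simp at this
  have hm : (0 : ℝ) ≤ m := Nat.cast_nonneg m
  linarith

theorem hasDerivAt_Gamma_quarterLine (u : ℝ) :
    HasDerivAt (fun v : ℝ => Gamma (1 / 4 + I * v / 2))
      (I / 2 * digamma (1 / 4 + I * u / 2) * Gamma (1 / 4 + I * u / 2)) u := by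
  have h1 : HasDerivAt (fun v : ℝ => (1 / 4 + I * v / 2 : ℂ)) (I / 2) u := by
    have := (((hasDerivAt_id u).ofReal_comp.const_mul I).div_const 2).const_add (1 / 4 : ℂ)
    simpa using this
  have h2 := (differentiableAt_Gamma _ (quarterLine_ne u)).hasDerivAt
  have h3 := h2.comp u h1
  have h4 : Gamma (1 / 4 + I * u / 2) ≠ 0 := Gamma_ne_zero (quarterLine_ne u)
  have h5 : I / 2 * digamma (1 / 4 + I * u / 2) * Gamma (1 / 4 + I * u / 2)
      = deriv Gamma (1 / 4 + I * u / 2) * (I / 2) := by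
    rw [digamma_def, logDeriv_apply, mul_assoc, div_mul_cancel₀ _ h4, mul_comm]
  rw [h5]
  exact h3

theorem continuous_digamma_quarterLine :
    Continuous (fun u : ℝ => digamma (1 / 4 + I * u / 2)) := by
  have hU : IsOpen {s : ℂ | 0 < s.re} := isOpen_lt continuous_const continuous_re
  have hne : ∀ s ∈ {s : ℂ | 0 < s.re}, ∀ m : ℕ, s ≠ -m := by
    intro s hs m h
    have hs' : 0 < s.re := hs
    have hm : (0 : ℝ) ≤ m := Nat.cast_nonneg m
    rw [h] at hs'
    simp at hs'
    linarith
  have hd : DifferentiableOn ℂ Gamma {s : ℂ | 0 < s.re} := fun s hs =>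
    (differentiableAt_Gamma s (hne s hs)).differentiableWithinAt
  have hc : ContinuousOn digamma {s : ℂ | 0 < s.re} := by
    have : ContinuousOn (fun s => deriv Gamma s / Gamma s) {s : ℂ | 0 < s.re} :=
      (hd.deriv hU).continuousOn.div hd.continuousOn
        (fun s hs => Gamma_ne_zero (hne s hs))
    exact this
  exact hc.comp_continuous (by fun_prop) (fun u => by simp)

/-- `ϑ(t)` is an argument of `π^{-s/2} Γ(s/2)` at `s = 1/2 + it`. -/
theorem exists_Gammaℝ_eq_mul_exp_siegelTheta (t : ℝ) :
    ∃ r : ℝ, 0 < r ∧ Gammaℝ (1 / 2 + I * t) = r * exp (I * siegelTheta t) := by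
  set f : ℝ → ℂ := fun u => I / 2 * digamma (1 / 4 + I * u / 2) with hf
  have hfc : Continuous f := continuous_const.mul continuous_digamma_quarterLine
  set H : ℝ → ℂ := fun v => ∫ u in (0 : ℝ)..v, f u with hH
  have hHd : ∀ v, HasDerivAt H (f v) v := fun v =>
    (hfc.integral_hasStrictDerivAt 0 v).hasDerivAt
  have hconst : ∀ v, HasDerivAt
      (fun v : ℝ => Gamma (1 / 4 + I * v / 2) * exp (-(H v))) 0 v := by
    intro v
    have := (hasDerivAt_Gamma_quarterLine v).mul ((hHd v).neg.cexp)
    have e : I / 2 * digamma (1 / 4 + I * v / 2) * Gamma (1 / 4 + I * v / 2) * exp ((-H) v)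
        + Gamma (1 / 4 + I * v / 2) * (exp ((-H) v) * -f v) = 0 := by
      simp only [hf]
      ring
    rw [e] at this
    exact this
  have hG : Gamma (1 / 4 + I * t / 2) = Gamma (1 / 4) * exp (H t) := by
    have h := is_const_of_deriv_eq_zero (fun v => (hconst v).differentiableAt)
      (fun v => (hconst v).deriv) t 0
    have h0 : H 0 = 0 := by simp [hH]
    simp only [h0, ofReal_zero, mul_zero, zero_div, add_zero, neg_zero, exp_zero, mul_one] at h
    rw [← h, mul_assoc, ← exp_add]
    simp
  have hIm : (H t).im = ∫ u in (0 : ℝ)..t, (digamma (1 / 4 + I * u / 2)).re / 2 := by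
    have h2 := imCLM.intervalIntegral_comp_comm
      (hfc.intervalIntegrable (μ := MeasureTheory.volume) 0 t)
    simp only [imCLM_apply] at h2
    rw [hH, ← h2]
    refine intervalIntegral.integral_congr fun u _ => ?_
    simp [hf, mul_im]
    ring
  have hΓ : Gamma (1 / 4 : ℂ) = ((Real.Gamma (1 / 4) : ℝ) : ℂ) := by
    rw [← Gamma_ofReal]
    norm_num
  refine ⟨Real.exp (-(1 / 4) * Real.log π) * Real.Gamma (1 / 4) * Real.exp (H t).re,
    by positivity, ?_⟩
  have hs : (1 / 2 + I * t : ℂ) / 2 = 1 / 4 + I * t / 2 := by ring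
  rw [Gammaℝ_def, hs, hG, hΓ, cpow_def_of_ne_zero (by exact_mod_cast Real.pi_ne_zero),
    ← ofReal_log Real.pi_pos.le]
  conv_lhs => rw [← re_add_im (H t)]
  rw [hIm, siegelTheta]
  push_cast
  have e1 : ∀ a b c : ℂ, exp a * (c * exp b) = c * exp (a + b) := fun a b c => by
    rw [exp_add]; ring
  have e2 : ∀ a b c d : ℂ, exp a * c * exp b * exp d = c * exp (a + b + d) := fun a b c d => by
    rw [exp_add, exp_add]; ring
  rw [e1, e2]
  congr 2
  ring

/-- `ζ(1/2 + it) = e^{-iϑ(t)} Z(t)`. -/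
theorem riemannZeta_eq_exp_mul_hardyZ (t : ℝ) :
    riemannZeta (1 / 2 + I * t) = exp (-(I * siegelTheta t)) * hardyZ t := by
  obtain ⟨r, hr, hG⟩ := exists_Gammaℝ_eq_mul_exp_siegelTheta t
  have hs0 : (1 / 2 + I * t : ℂ) ≠ 0 := by
    intro h
    have := congrArg Complex.re h
    simp at this
  have hs1 : (1 - (1 / 2 + I * t) : ℂ) ≠ 0 := by
    intro h
    have := congrArg Complex.re h
    norm_num at this
  have hconj : (starRingEnd ℂ) (1 / 2 + I * t) = 1 - (1 / 2 + I * t) := by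
    simp only [map_add, map_div₀, map_one, map_ofNat, map_mul, conj_I, conj_ofReal]
    ring
  have hΛ : completedRiemannZeta (1 / 2 + I * t)
      = r * (exp (I * siegelTheta t) * riemannZeta (1 / 2 + I * t)) := by
    have hne : Gammaℝ (1 / 2 + I * t) ≠ 0 := by
      rw [hG]
      exact mul_ne_zero (by exact_mod_cast hr.ne') (exp_ne_zero _)
    rw [← mul_assoc, ← hG, riemannZeta_def_of_ne_zero hs0, mul_div_cancel₀ _ hne]
  have hGc : ∀ s : ℂ, Gammaℝ ((starRingEnd ℂ) s) = (starRingEnd ℂ) (Gammaℝ s) := by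
    intro s
    have hπ : (π : ℂ) ≠ 0 := by exact_mod_cast Real.pi_ne_zero
    rw [Gammaℝ_def, Gammaℝ_def, map_mul, ← Gamma_conj, cpow_def_of_ne_zero hπ,
      cpow_def_of_ne_zero hπ, ← exp_conj, ← ofReal_log Real.pi_pos.le]
    simp only [map_mul, map_div₀, map_neg, map_ofNat, conj_ofReal]
  have hreal : (starRingEnd ℂ) (completedRiemannZeta (1 / 2 + I * t))
      = completedRiemannZeta (1 / 2 + I * t) := by
    have hmul : ∀ s : ℂ, s ≠ 0 → Gammaℝ s ≠ 0 →
        completedRiemannZeta s = Gammaℝ s * riemannZeta s := by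
      intro s h0 h1
      rw [riemannZeta_def_of_ne_zero h0, mul_div_cancel₀ _ h1]
    have hg : Gammaℝ (1 / 2 + I * t) ≠ 0 := by
      rw [hG]
      exact mul_ne_zero (by exact_mod_cast hr.ne') (exp_ne_zero _)
    have hg1 : Gammaℝ (1 - (1 / 2 + I * t)) ≠ 0 := by
      rw [← hconj, hGc]
      simpa using hg
    conv_rhs => rw [← completedRiemannZeta_one_sub]
    rw [hmul _ hs0 hg, hmul _ hs1 hg1, map_mul, ← hGc, ← riemannZeta_conj, hconj]
  have hz : ((hardyZ t : ℝ) : ℂ) = exp (I * siegelTheta t) * riemannZeta (1 / 2 + I * t) := by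
    rw [hardyZ]
    apply conj_eq_iff_re.mp
    rw [hΛ, map_mul, conj_ofReal] at hreal
    exact mul_left_cancel₀ (by exact_mod_cast hr.ne') hreal
  rw [hz, ← mul_assoc, ← exp_add]
  simp

end

noncomputable section

open Metric Filter Topology

/-! Put `s = 1/2 + it` and let `ξ` stand for `riemannXi`, which is `s (1 - s) Gammaℝ(s) ζ(s)` on the
right half plane away from `s = 1`. Since `Z = e^{iϑ} ζ` is real, taking real parts expresses `Z'/Z`
through `i ξ'/ξ`, a rational term and `Im ψ(s/2) / 2`. Differentiating in `t`, `(Z'/Z)'` equals `-Re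
(ξ'/ξ)'(s)` up to `O(1/t²)` from the rational term and `O(1/t)` from the trigamma function
(`hasDerivAt_deriv_hardyZ_div`, `norm_deriv_digamma_le`).

It remains to see that `(ξ'/ξ)'(s) = -∑ (s - ρ)⁻²`. Under RH `s - ρ = i(t - γ)`, so the right side
is `∑ (t - γ)⁻²` (`hasSum_zeroTerm`). No Hadamard product is used. Dividing `ξ` by its zeros in a
disc of radius `R` leaves a zero-free function there; Borel–Carathéodory and Cauchy bound the second
derivative of its logarithm by `O(M/R²)`, where `M` measures the growth of `ξ` on `|w| = 2R`
(`norm_deriv_logDeriv_add_sum_le`). As `M = O(R log R)` (`exists_norm_riemannXi_le`), this error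
tends to zero. The same disc estimate, applied to `Gamma`, controls the tail in the trigamma bound.
-/

/-! ### Second logarithmic derivatives of holomorphic functions -/

/-- A zero-free holomorphic function on a disc whose modulus is controlled by its value at the
centre has a small second logarithmic derivative near the centre. -/
theorem norm_deriv_logDeriv_le_of_ne_zero {g : ℂ → ℂ} {c z : ℂ} {R M : ℝ} (hR : 0 < R) (hM : 0 < M)
    (hg : DifferentiableOn ℂ g (ball c R)) (h0 : ∀ w ∈ ball c R, g w ≠ 0)
    (hle : ∀ w ∈ ball c R, ‖g w‖ ≤ Real.exp M * ‖g c‖) (hz : ‖z - c‖ < R / 4) :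
    ‖deriv (logDeriv g) z‖ ≤ 64 * M / R ^ 2 := by
  have hcm : c ∈ ball c R := mem_ball_self hR
  have hdl : DifferentiableOn ℂ (logDeriv g) (ball c R) :=
    (hg.deriv isOpen_ball).div hg h0
  -- A primitive `h` of `g'/g` with `h c = 0` is a branch of `log (g / g c)`; the growth hypothesis
  -- then reads `Re h ≤ M`.
  obtain ⟨h, hc, hh⟩ := hdl.isExactOn_ball.with_val_at c 0
  have hgh : ∀ w ∈ ball c R, HasDerivAt (fun w => g w * exp (-h w)) 0 w := by
    intro w hw
    have h1 := (hg.differentiableAt (isOpen_ball.mem_nhds hw)).hasDerivAt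
    refine (h1.mul (hh w hw).neg.cexp).congr_deriv ?_
    have := h0 w hw
    rw [logDeriv_apply]
    field_simp
    simp
  have hconst : ∀ w ∈ ball c R, g w * exp (-h w) = g c := by
    intro w hw
    have := (convex_ball c R).is_const_of_fderivWithin_eq_zero (𝕜 := ℂ)
      (f := fun w => g w * exp (-h w))
      (fun w hw => (hgh w hw).differentiableAt.differentiableWithinAt)
      (fun w hw => by
        rw [fderivWithin_of_isOpen isOpen_ball hw]
        ext
        simp [(hgh w hw).deriv]) hw hcm
    simpa [hc] using this
  have hre : ∀ w ∈ ball c R, (h w).re ≤ M := by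
    intro w hw
    have e : g w = g c * exp (h w) := by
      rw [← hconst w hw, mul_assoc, ← exp_add]
      simp
    have h2 := hle w hw
    have hpos : 0 < ‖g c‖ := norm_pos_iff.2 (h0 c hcm)
    rw [e, norm_mul, Complex.norm_exp, mul_comm] at h2
    exact Real.exp_le_exp.1 (le_of_mul_le_mul_right h2 hpos)
  have hbound : ∀ w ∈ ball c (R / 2), ‖h w‖ ≤ 2 * M := by
    intro w hw
    rw [mem_ball_iff_norm] at hw
    have hsub : ∀ x ∈ ball (0 : ℂ) R, c + x ∈ ball c R := by
      intro x hx
      simpa using hx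
    have hdiff : DifferentiableOn ℂ (fun x => h (c + x)) (ball 0 R) := by
      intro x hx
      exact (((hh _ (hsub x hx)).differentiableAt).comp x
        (by fun_prop : DifferentiableAt ℂ (fun x => c + x) x)).differentiableWithinAt
    have := borelCaratheodory_zero (f := fun x => h (c + x)) (z := w - c) hM hdiff
      (fun x hx => hre _ (hsub x hx)) hR (by simp; linarith) (by simpa using hc)
    rw [add_sub_cancel] at this
    refine this.trans ?_
    rw [div_le_iff₀ (by linarith)]
    gcongr
    linarith
  have hsphere : closedBall z (R / 4) ⊆ ball c (R / 2) := by
    intro w hw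
    rw [mem_closedBall_iff_norm] at hw
    rw [mem_ball_iff_norm]
    calc ‖w - c‖ = ‖(w - z) + (z - c)‖ := by ring_nf
      _ ≤ ‖w - z‖ + ‖z - c‖ := norm_add_le _ _
      _ < R / 2 := by linarith
  have hsub2 : ball c (R / 2) ⊆ ball c R := ball_subset_ball (by linarith)
  have hdc : DiffContOnCl ℂ h (ball z (R / 4)) := by
    apply DifferentiableOn.diffContOnCl
    rw [closure_ball _ (by positivity)]
    exact fun w hw => (hh w (hsub2 (hsphere hw))).differentiableAt.differentiableWithinAt
  -- Cauchy's estimate on radius `R / 4` gives `2! * 2M / (R/4)² = 64 M / R²`.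
  have hC := norm_iteratedDeriv_le_of_forall_mem_sphere_norm_le 2 (by positivity : 0 < R / 4) hdc
    (C := 2 * M) (fun w hw => hbound w (hsphere (sphere_subset_closedBall hw)))
  have hzm : z ∈ ball c R := by
    rw [mem_ball_iff_norm]
    linarith
  have e : iteratedDeriv 2 h z = deriv (logDeriv g) z := by
    rw [iteratedDeriv_succ, iteratedDeriv_one]
    apply Filter.EventuallyEq.deriv_eq
    filter_upwards [isOpen_ball.mem_nhds hzm] with w hw using (hh w hw).deriv
  rw [e] at hC
  refine hC.trans (le_of_eq ?_)
  simp [Nat.factorial]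
  field_simp
  ring

/-- Splitting off a zero of an entire function. -/
theorem exists_differentiable_eq_pow_mul {f : ℂ → ℂ} (hf : Differentiable ℂ f) (ρ : ℂ)
    (hρ : analyticOrderAt f ρ ≠ ⊤) :
    ∃ g : ℂ → ℂ, Differentiable ℂ g ∧ g ρ ≠ 0 ∧
      ∀ z, f z = (z - ρ) ^ analyticOrderNatAt f ρ * g z := by
  classical
  obtain ⟨g, hga, hg0, hfg⟩ := (hf.analyticAt ρ).analyticOrderAt_ne_top.1 hρ
  set n := analyticOrderNatAt f ρ
  have hG : ∀ z ≠ ρ, Function.update (fun z => f z / (z - ρ) ^ n) ρ (g ρ) z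
      = f z / (z - ρ) ^ n := fun z hz => Function.update_of_ne hz _ _
  -- The global quotient is `f / (z - ρ)^n`, with its removable singularity filled in by the local
  -- cofactor.
  refine ⟨Function.update (fun z => f z / (z - ρ) ^ n) ρ (g ρ), fun z => ?_, by simpa, fun z => ?_⟩
  · by_cases hz : z = ρ
    · subst hz
      refine hga.differentiableAt.congr_of_eventuallyEq ?_
      filter_upwards [hfg] with w hw
      by_cases hwz : w = z
      · simp [hwz]
      · rw [hG w hwz, hw, smul_eq_mul, mul_div_cancel_left₀]
        exact pow_ne_zero _ (sub_ne_zero.2 hwz)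
    · have : DifferentiableAt ℂ (fun z => f z / (z - ρ) ^ n) z :=
        (hf z).div (by fun_prop) (pow_ne_zero _ (sub_ne_zero.2 hz))
      refine this.congr_of_eventuallyEq ?_
      filter_upwards [isOpen_ne.mem_nhds hz] with w hw using hG w hw
  · by_cases hz : z = ρ
    · subst hz
      simpa using hfg.self_of_nhds
    · rw [hG z hz, mul_div_cancel₀]
      exact pow_ne_zero _ (sub_ne_zero.2 hz)

/-- Splitting off finitely many zeros of an entire function. -/
theorem exists_differentiable_eq_prod_mul {f : ℂ → ℂ} (hf : Differentiable ℂ f)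
    (hf0 : ∃ z, f z ≠ 0) (S : Finset ℂ) :
    ∃ g : ℂ → ℂ, Differentiable ℂ g ∧ (∀ ρ ∈ S, g ρ ≠ 0) ∧
      ∀ z, f z = (∏ ρ ∈ S, (z - ρ) ^ analyticOrderNatAt f ρ) * g z := by
  classical
  induction S using Finset.induction_on with
  | empty => exact ⟨f, hf, by simp, by simp⟩
  | insert a S ha ih =>
    obtain ⟨g, hg, hgS, hfg⟩ := ih
    set P : ℂ → ℂ := fun z => ∏ ρ ∈ S, (z - ρ) ^ analyticOrderNatAt f ρ
    have hPd : Differentiable ℂ P := by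
      have : ∀ ρ ∈ S, Differentiable ℂ fun z : ℂ => (z - ρ) ^ analyticOrderNatAt f ρ :=
        fun ρ _ => by fun_prop
      exact Differentiable.fun_finsetProd this
    have hPa : P a ≠ 0 := Finset.prod_ne_zero_iff.2 fun ρ hρ =>
      pow_ne_zero _ (sub_ne_zero.2 fun h => ha (h ▸ hρ))
    -- The factors already removed do not vanish at `a`, so the cofactor keeps the full order of `f`
    -- there.
    have hord : analyticOrderAt f a = analyticOrderAt g a := by
      have : f = P * g := funext hfg
      conv_lhs => rw [this]
      rw [analyticOrderAt_mul (hPd.analyticAt a) (hg.analyticAt a),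
        (hPd.analyticAt a).analyticOrderAt_eq_zero.2 hPa, zero_add]
    have htop : analyticOrderAt g a ≠ ⊤ := by
      rw [← hord]
      intro h
      rw [analyticOrderAt_eq_top] at h
      obtain ⟨z, hz⟩ := hf0
      have := AnalyticOnNhd.eq_of_eventuallyEq (𝕜 := ℂ) (f := f) (g := 0)
        (fun w _ => hf.analyticAt w) (fun w _ => analyticAt_const) (z₀ := a) h
      exact hz (congrFun this z)
    obtain ⟨k, hk, hka, hgk⟩ := exists_differentiable_eq_pow_mul hg a htop
    have hn : analyticOrderNatAt g a = analyticOrderNatAt f a := by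
      rw [analyticOrderNatAt, analyticOrderNatAt, hord]
    refine ⟨k, hk, fun ρ hρ => ?_, fun z => ?_⟩
    · rcases Finset.mem_insert.1 hρ with rfl | hρ
      · exact hka
      · intro h
        exact hgS ρ hρ (by rw [hgk, h, mul_zero])
    · rw [Finset.prod_insert ha, hfg z, hgk z, hn]
      ring

theorem deriv_logDeriv_mul {f g : ℂ → ℂ} {z : ℂ} (hf : AnalyticAt ℂ f z) (hg : AnalyticAt ℂ g z)
    (hf0 : f z ≠ 0) (hg0 : g z ≠ 0) :
    deriv (logDeriv fun w => f w * g w) z = deriv (logDeriv f) z + deriv (logDeriv g) z := by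
  have h1 : (logDeriv fun w => f w * g w) =ᶠ[𝓝 z] fun w => logDeriv f w + logDeriv g w := by
    filter_upwards [hf.eventually_analyticAt, hg.eventually_analyticAt,
      hf.continuousAt.eventually_ne hf0, hg.continuousAt.eventually_ne hg0] with w a b c d
    exact logDeriv_mul w c d a.differentiableAt b.differentiableAt
  rw [h1.deriv_eq]
  exact deriv_fun_add (hf.deriv.div hf hf0).differentiableAt (hg.deriv.div hg hg0).differentiableAt

theorem deriv_logDeriv_sub_pow {z ρ : ℂ} (n : ℕ) (hz : z ≠ ρ) :
    deriv (logDeriv fun w => (w - ρ) ^ n) z = -(n / (z - ρ) ^ 2) := by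
  have h1 : (logDeriv fun w => (w - ρ) ^ n) =ᶠ[𝓝 z] fun w => (n : ℂ) * (w - ρ)⁻¹ := by
    filter_upwards with w
    rw [logDeriv_fun_pow (by fun_prop), logDeriv_apply]
    simp
  rw [h1.deriv_eq]
  have h2 : HasDerivAt (fun w => (w - ρ)⁻¹) (-1 / (z - ρ) ^ 2) z :=
    ((hasDerivAt_id z).sub_const ρ).inv (sub_ne_zero.2 hz)
  rw [(h2.const_mul (n : ℂ)).deriv]
  ring

theorem deriv_logDeriv_prod_sub_pow {z : ℂ} (S : Finset ℂ) (m : ℂ → ℕ) (hz : z ∉ S) :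
    deriv (logDeriv fun w => ∏ ρ ∈ S, (w - ρ) ^ m ρ) z = -∑ ρ ∈ S, m ρ / (z - ρ) ^ 2 := by
  classical
  induction S using Finset.induction_on with
  | empty => simp [logDeriv_const, Pi.zero_def]
  | insert a S ha ih =>
    simp only [Finset.mem_insert, not_or] at hz
    simp only [Finset.prod_insert ha, Finset.sum_insert ha]
    have hP : ∏ ρ ∈ S, (z - ρ) ^ m ρ ≠ 0 := Finset.prod_ne_zero_iff.2 fun ρ hρ =>
      pow_ne_zero _ (sub_ne_zero.2 fun h => hz.2 (h ▸ hρ))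
    rw [deriv_logDeriv_mul (f := fun w => (w - a) ^ m a) (g := fun w => ∏ ρ ∈ S, (w - ρ) ^ m ρ)
      (by fun_prop) (by fun_prop) (pow_ne_zero _ (sub_ne_zero.2 hz.1)) hP, ih hz.2,
      deriv_logDeriv_sub_pow _ hz.1]
    ring

/-- The second logarithmic derivative of an entire function is minus the sum of `1 / (z - ρ)²`
over the zeros in a disc, up to an error controlled by the growth on the disc of twice the
radius. -/
theorem norm_deriv_logDeriv_add_sum_le {f : ℂ → ℂ} (hf : Differentiable ℂ f) (hf0 : f 0 ≠ 0)
    {R M : ℝ} (hR : 0 < R) (hM : 0 < M) (hle : ∀ w, ‖w‖ = 2 * R → ‖f w‖ ≤ Real.exp M * ‖f 0‖)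
    {S : Finset ℂ} (hS : ∀ ρ, ρ ∈ S ↔ ‖ρ‖ ≤ R ∧ f ρ = 0) {z : ℂ} (hz : ‖z‖ < R / 4)
    (hfz : f z ≠ 0) :
    ‖deriv (logDeriv f) z + ∑ ρ ∈ S, analyticOrderNatAt f ρ / (z - ρ) ^ 2‖ ≤ 64 * M / R ^ 2 := by
  obtain ⟨g, hg, hgS, hfg⟩ := exists_differentiable_eq_prod_mul hf ⟨0, hf0⟩ S
  set P : ℂ → ℂ := fun z => ∏ ρ ∈ S, (z - ρ) ^ analyticOrderNatAt f ρ with hP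
  have hPd : AnalyticAt ℂ P z := by
    rw [hP]
    fun_prop
  have hzS : z ∉ S := fun h => hfz ((hS z).1 h).2
  have hPz : P z ≠ 0 := left_ne_zero_of_mul (hfg z ▸ hfz)
  have hgz : g z ≠ 0 := right_ne_zero_of_mul (hfg z ▸ hfz)
  have hP0 : P 0 ≠ 0 := left_ne_zero_of_mul (hfg 0 ▸ hf0)
  -- The reason for the doubled radius: if `|ρ| ≤ R` and `|w| = 2R`, then `|w - ρ| ≥ R ≥ |ρ|`.
  -- Dividing by `P` therefore does not worsen the growth relative to the centre, and the maximum
  -- principle carries the bound inside.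
  have hPle : ∀ w, ‖w‖ = 2 * R → ‖P 0‖ ≤ ‖P w‖ := by
    intro w hw
    simp only [hP, norm_prod, norm_pow]
    refine Finset.prod_le_prod (fun _ _ => by positivity) fun ρ hρ => ?_
    gcongr
    have h1 := ((hS ρ).1 hρ).1
    have h2 := norm_sub_norm_le w ρ
    rw [zero_sub, norm_neg]
    linarith
  have hgle : ∀ w ∈ ball (0 : ℂ) (2 * R), ‖g w‖ ≤ Real.exp M * ‖g 0‖ := by
    intro w hw
    refine norm_le_of_forall_mem_frontier_norm_le (isBounded_ball (x := 0) (r := 2 * R))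
      hg.diffContOnCl ?_ (subset_closure hw)
    intro x hx
    rw [frontier_ball _ (by positivity)] at hx
    have hx' : ‖x‖ = 2 * R := by simpa using hx
    have h1 := hle x hx'
    rw [hfg x, hfg 0, norm_mul, norm_mul] at h1
    have h2 := hPle x hx'
    have h3 : 0 < ‖P 0‖ := norm_pos_iff.2 hP0
    refine le_of_mul_le_mul_left ?_ h3
    calc ‖P 0‖ * ‖g x‖ ≤ ‖P x‖ * ‖g x‖ := by gcongr
      _ ≤ _ := h1
      _ = _ := by ring
  have hgne : ∀ w ∈ ball (0 : ℂ) R, g w ≠ 0 := by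
    intro w hw h
    have hw' : ‖w‖ < R := by simpa using hw
    exact hgS w ((hS w).2 ⟨hw'.le, by rw [hfg, h, mul_zero]⟩) h
  have key := norm_deriv_logDeriv_le_of_ne_zero hR hM hg.differentiableOn hgne
    (fun w hw => hgle w (ball_subset_ball (by linarith) hw)) (z := z) (by simpa using hz)
  have e : deriv (logDeriv f) z = deriv (logDeriv P) z + deriv (logDeriv g) z := by
    rw [← deriv_logDeriv_mul hPd (hg.analyticAt z) hPz hgz]
    congr 2
    exact funext hfg
  rw [e, hP, deriv_logDeriv_prod_sub_pow S _ hzS]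
  rwa [neg_add_eq_sub, sub_add_cancel]

/-! ### Bounds for the Gamma and trigamma functions -/

theorem norm_Gamma_le {s : ℂ} (hs : 0 < s.re) : ‖Gamma s‖ ≤ Real.Gamma s.re := by
  rw [Gamma_eq_integral hs, GammaIntegral, Real.Gamma_eq_integral hs]
  refine (MeasureTheory.norm_integral_le_integral_norm _).trans (le_of_eq ?_)
  refine MeasureTheory.setIntegral_congr_fun measurableSet_Ioi fun x hx => ?_
  have hx' : (0 : ℝ) < x := hx
  simp [norm_cpow_eq_rpow_re_of_pos hx', Complex.norm_exp]

/-- Convexity bounds Gamma on `[1, n + 1]` by its larger endpoint value; monotonicity, which fails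
near `1`, is not needed. -/
theorem Real.Gamma_le_factorial {x : ℝ} {n : ℕ} (h1 : 1 ≤ x) (hx : x ≤ n + 1) :
    Real.Gamma x ≤ n.factorial := by
  have h := Real.convexOn_Gamma.le_max_of_mem_Icc (x := (1 : ℝ)) (y := (n : ℝ) + 1) (z := x)
    (by simp) (by simp only [mem_Ioi]; positivity) ⟨h1, hx⟩
  rw [Real.Gamma_one, Real.Gamma_nat_eq_factorial] at h
  refine h.trans (max_le ?_ le_rfl)
  exact_mod_cast Nat.one_le_iff_ne_zero.2 n.factorial_ne_zero

theorem factorial_le_exp_mul_log {n : ℕ} (hn : 1 ≤ n) :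
    (n.factorial : ℝ) ≤ Real.exp (n * Real.log n) := by
  have h0 : (0 : ℝ) < n := by exact_mod_cast hn
  rw [mul_comm, Real.exp_mul, Real.exp_log h0, Real.rpow_natCast]
  exact_mod_cast n.factorial_le_pow

theorem Gamma_re_pos_ne {s : ℂ} (hs : 0 < s.re) (m : ℕ) : s ≠ -m := by
  rintro rfl
  have : (0 : ℝ) ≤ m := Nat.cast_nonneg m
  simp at hs
  linarith

theorem analyticAt_Gamma {s : ℂ} (hs : 0 < s.re) : AnalyticAt ℂ Gamma s := by
  have hd : DifferentiableOn ℂ Gamma {s : ℂ | 0 < s.re} := fun s hs =>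
    (differentiableAt_Gamma s (Gamma_re_pos_ne hs)).differentiableWithinAt
  exact hd.analyticAt ((isOpen_lt continuous_const continuous_re).mem_nhds hs)

theorem analyticAt_digamma {s : ℂ} (hs : 0 < s.re) : AnalyticAt ℂ digamma s :=
  (analyticAt_Gamma hs).deriv.div (analyticAt_Gamma hs) (Gamma_ne_zero_of_re_pos hs)

theorem deriv_digamma_add_one {s : ℂ} (hs : 0 < s.re) :
    deriv digamma s = 1 / s ^ 2 + deriv digamma (s + 1) := by
  have h1 : (fun w => digamma (w + 1)) =ᶠ[𝓝 s] fun w => digamma w + w⁻¹ := by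
    filter_upwards [(isOpen_lt continuous_const continuous_re).mem_nhds hs] with w hw
    exact digamma_apply_add_one w (Gamma_re_pos_ne hw)
  have h2 := h1.deriv_eq
  have hs0 : s ≠ 0 := by
    rintro rfl
    simp at hs
  rw [deriv_comp_add_const, deriv_fun_add (analyticAt_digamma hs).differentiableAt
    (differentiableAt_inv hs0), deriv_inv] at h2
  rw [h2]
  field_simp
  ring

theorem deriv_digamma_add_natCast {s : ℂ} (hs : 0 < s.re) (n : ℕ) :
    deriv digamma s = ∑ k ∈ Finset.range n, 1 / (s + k) ^ 2 + deriv digamma (s + n) := by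
  induction n with
  | zero => simp
  | succ n ih =>
    have hn : 0 < (s + n).re := by
      simp
      positivity
    rw [ih, deriv_digamma_add_one hn, Finset.sum_range_succ]
    push_cast
    ring_nf

theorem tendsto_log_div_self_nat {a : ℝ} (ha : 0 < a) :
    Tendsto (fun n : ℕ => Real.log (a * n) / n) atTop (𝓝 0) := by
  have h := Real.isLittleO_log_id_atTop.tendsto_div_nhds_zero
  have h2 : Tendsto (fun n : ℕ => a * (n : ℝ)) atTop atTop :=
    tendsto_natCast_atTop_atTop.const_mul_atTop ha
  have h3 := (h.comp h2).const_mul a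
  rw [mul_zero] at h3
  refine h3.congr fun n => ?_
  simp only [Function.comp_apply, id_eq]
  rcases eq_or_ne (n : ℝ) 0 with hn | hn
  · simp [hn]
  · field_simp

/-- The zero-free disc estimate is applied to `Gamma` on the disc of centre `2n` and radius `n`,
where `|Γ| ≤ (3n)!`. With `M = 3n log (3n)` the bound is `192 log (3n) / n`. -/
theorem tendsto_deriv_digamma_add_natCast (s : ℂ) :
    Tendsto (fun n : ℕ => deriv digamma (s + (2 * n : ℕ))) atTop (𝓝 0) := by
  have hlim : Tendsto (fun n : ℕ => 192 * (Real.log (3 * n) / n)) atTop (𝓝 0) := by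
    simpa using (tendsto_log_div_self_nat (by norm_num : (0 : ℝ) < 3)).const_mul 192
  refine squeeze_zero_norm' ?_ hlim
  filter_upwards [eventually_ge_atTop 1,
    (tendsto_natCast_atTop_atTop (R := ℝ)).eventually_gt_atTop (4 * ‖s‖)] with n hn hns
  have hn0 : (1 : ℝ) ≤ n := by exact_mod_cast hn
  have hre : ∀ w ∈ ball ((2 * n : ℕ) : ℂ) n, (n : ℝ) < w.re ∧ w.re < 3 * n := by
    intro w hw
    rw [mem_ball_iff_norm] at hw
    have h := (abs_re_le_norm _).trans_lt hw
    rw [abs_lt] at h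
    simp at h
    constructor <;> linarith
  have hM : 0 < (3 * n : ℕ) * Real.log (3 * n : ℕ) := by
    have : (1 : ℝ) < (3 * n : ℕ) := by
      push_cast
      linarith
    have := Real.log_pos this
    positivity
  have key := norm_deriv_logDeriv_le_of_ne_zero (g := Gamma) (c := ((2 * n : ℕ) : ℂ))
    (z := s + (2 * n : ℕ)) (R := n) (by linarith) hM
    (fun w hw => (analyticAt_Gamma (by linarith [(hre w hw).1])).differentiableAt.differentiableWithinAt)
    (fun w hw => Gamma_ne_zero_of_re_pos (by linarith [(hre w hw).1]))
    (fun w hw => ?_) (by simp; linarith)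
  · refine key.trans (le_of_eq ?_)
    push_cast
    field_simp
    ring
  · have h1 := (hre w hw).1
    have h2 := (norm_Gamma_le (s := w) (by linarith)).trans
      (Real.Gamma_le_factorial (n := 3 * n) (by linarith) (by push_cast; linarith [(hre w hw).2]))
    have h3 := h2.trans (factorial_le_exp_mul_log (by lia))
    refine h3.trans (le_mul_of_one_le_right (Real.exp_pos _).le ?_)
    -- At the centre `Γ(2n) = (2n - 1)! ≥ 1`, so an absolute bound on the disc is also a relative
    -- one.
    obtain ⟨m, hm⟩ : ∃ m, 2 * n = m + 1 := ⟨2 * n - 1, by lia⟩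
    rw [hm]
    push_cast
    rw [Gamma_nat_eq_factorial]
    simp only [norm_natCast]
    exact_mod_cast Nat.one_le_iff_ne_zero.2 m.factorial_ne_zero

theorem sum_one_div_add_sq_le {a : ℝ} (ha : 1 ≤ a) (n : ℕ) :
    ∑ k ∈ Finset.range n, 1 / (a + k) ^ 2 ≤ 2 / a := by
  -- Telescoping from `1/x² ≤ 1/(x - 1/2) - 1/(x + 1/2)`; the subtracted term makes the induction
  -- close.
  have h : ∑ k ∈ Finset.range n, 1 / (a + k) ^ 2 ≤ 2 / a - 1 / (a + n - 1 / 2) := by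
    induction n with
    | zero =>
      have : 1 / (a - 1 / 2) ≤ 2 / a := by
        rw [div_le_div_iff₀ (by linarith) (by linarith)]
        linarith
      simpa using this
    | succ n ih =>
      have hn : (0 : ℝ) ≤ n := Nat.cast_nonneg n
      rw [Finset.sum_range_succ]
      push_cast
      set x := a + n with hx
      have hx1 : 1 ≤ x := by linarith
      have h1 : 1 / x ^ 2 ≤ 1 / (x - 1 / 2) - 1 / (x + 1 / 2) := by
        rw [div_sub_div _ _ (by linarith) (by linarith), div_le_div_iff₀ (by positivity)
          (by nlinarith)]
        nlinarith
      have e : a + (n + 1) - 1 / 2 = x + 1 / 2 := by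
        rw [hx]
        ring
      rw [e]
      linarith
  have hn : (0 : ℝ) ≤ n := Nat.cast_nonneg n
  have h2 : 0 ≤ 1 / (a + n - 1 / 2) := div_nonneg zero_le_one (by linarith)
  linarith

/-- The trigamma function is `O(1/|Im s|)` on the right half plane. -/
theorem norm_deriv_digamma_le {s : ℂ} (hs : 0 < s.re) (him : 1 ≤ s.im) :
    ‖deriv digamma s‖ ≤ 8 / s.im := by
  have h1 : ∀ n : ℕ, ‖deriv digamma s‖ ≤ 4 / s.im + ‖deriv digamma (s + (2 * n : ℕ))‖ := by
    intro n
    rw [deriv_digamma_add_natCast hs (2 * n)]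
    refine (norm_add_le _ _).trans (add_le_add_left ?_ _)
    refine (norm_sum_le _ _).trans ?_
    have h2 := sum_one_div_add_sq_le him (2 * n)
    -- Since `Re s > 0`, `|s + k|² ≥ k² + (Im s)² ≥ (k + Im s)² / 2`.
    calc _ ≤ ∑ k ∈ Finset.range (2 * n), 2 * (1 / (s.im + k) ^ 2) := by
          refine Finset.sum_le_sum fun k _ => ?_
          have hk : (0 : ℝ) ≤ k := Nat.cast_nonneg k
          rw [norm_div, norm_one, norm_pow, ← normSq_eq_norm_sq, normSq_apply]
          simp only [add_re, natCast_re, add_im, natCast_im, add_zero]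
          rw [mul_one_div, div_le_div_iff₀ (by nlinarith) (by positivity)]
          nlinarith [sq_nonneg (s.im - k), mul_nonneg hs.le hk]
      _ = 2 * ∑ k ∈ Finset.range (2 * n), 1 / (s.im + k) ^ 2 := by rw [Finset.mul_sum]
      _ ≤ 2 * (2 / s.im) := by gcongr
      _ = 4 / s.im := by ring
  have h3 := ((tendsto_deriv_digamma_add_natCast s).norm).const_add (4 / s.im)
  rw [norm_zero, add_zero] at h3
  refine (ge_of_tendsto' h3 h1).trans ?_
  gcongr
  norm_num

/-! ### The xi function and its zeros -/

/-- The entire function `s (1 - s) Λ(s)`, which is `-2 ξ(s)` in Riemann's notation. -/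
def riemannXi (s : ℂ) : ℂ := s * (1 - s) * completedRiemannZeta₀ s - 1

theorem differentiable_riemannXi : Differentiable ℂ riemannXi := by
  have := differentiable_completedZeta₀
  unfold riemannXi
  fun_prop

theorem riemannXi_zero : riemannXi 0 = -1 := by simp [riemannXi]

theorem riemannXi_one : riemannXi 1 = -1 := by simp [riemannXi]

theorem riemannXi_one_sub (s : ℂ) : riemannXi (1 - s) = riemannXi s := by
  rw [riemannXi, riemannXi, completedRiemannZeta₀_one_sub]
  ring

theorem riemannXi_eq {s : ℂ} (h0 : 0 < s.re) (h1 : s ≠ 1) :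
    riemannXi s = s * (1 - s) * Gammaℝ s * riemannZeta s := by
  have hs0 : s ≠ 0 := by
    rintro rfl
    simp at h0
  have hs1 : 1 - s ≠ 0 := sub_ne_zero.2 h1.symm
  rw [mul_assoc, riemannZeta_def_of_ne_zero hs0, mul_div_cancel₀ _ (Gammaℝ_ne_zero_of_re_pos h0),
    completedRiemannZeta_eq, riemannXi]
  field_simp
  ring

theorem riemannXi_ne_zero_of_one_le_re {s : ℂ} (h : 1 ≤ s.re) : riemannXi s ≠ 0 := by
  by_cases h1 : s = 1
  · rw [h1, riemannXi_one]
    norm_num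
  · have hs : 0 < s.re := by linarith
    have hs0 : s ≠ 0 := by
      rintro rfl
      simp at hs
    rw [riemannXi_eq hs h1]
    exact mul_ne_zero (mul_ne_zero (mul_ne_zero hs0 (sub_ne_zero.2 (Ne.symm h1)))
      (Gammaℝ_ne_zero_of_re_pos hs)) (riemannZeta_ne_zero_of_one_le_re h)

/-- The zeros of `riemannXi` are the nontrivial zeros of `ζ`. -/
theorem riemannXi_eq_zero_iff {s : ℂ} : riemannXi s = 0 ↔ s ∈ nontrivialZetaZeros := by
  have hstrip : 0 < s.re → s.re < 1 → (riemannXi s = 0 ↔ riemannZeta s = 0) := by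
    intro h0 h1
    have hs0 : s ≠ 0 := by
      rintro rfl
      simp at h0
    have hs1 : s ≠ 1 := by
      rintro rfl
      simp at h1
    rw [riemannXi_eq h0 hs1]
    simp [hs0, sub_ne_zero.2 hs1.symm, Gammaℝ_ne_zero_of_re_pos h0]
  constructor
  · intro h
    have h1 : s.re < 1 := by
      by_contra! h1
      exact riemannXi_ne_zero_of_one_le_re h1 h
    have h0 : 0 < s.re := by
      by_contra! h0
      exact riemannXi_ne_zero_of_one_le_re (s := 1 - s) (by simp; linarith)
        (by rwa [riemannXi_one_sub])
    exact ⟨(hstrip h0 h1).1 h, h0, h1⟩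
  · rintro ⟨hz, h0, h1⟩
    exact (hstrip h0 h1).2 hz

theorem analyticAt_Gammaℝ {s : ℂ} (hs : 0 < s.re) : AnalyticAt ℂ Gammaℝ s := by
  have h1 : AnalyticAt ℂ (fun s : ℂ => Gamma (s / 2)) s :=
    (analyticAt_Gamma (s := s / 2) (by simpa using hs)).comp (f := fun s : ℂ => s / 2) (by fun_prop)
  have h2 : AnalyticAt ℂ (fun s : ℂ => (π : ℂ) ^ (-s / 2)) s := by
    have : (fun s : ℂ => (π : ℂ) ^ (-s / 2)) = fun s => exp (Complex.log π * (-s / 2)) :=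
      funext fun s => cpow_def_of_ne_zero (by exact_mod_cast Real.pi_ne_zero) _
    rw [this]
    fun_prop
  exact h2.mul h1

/-- The cofactor `s (1 - s) Gammaℝ(s)` is analytic and nonzero at `ρ`, so multiplicities can be
counted for either function. -/
theorem analyticOrderNatAt_riemannXi {ρ : ℂ} (h0 : 0 < ρ.re) (h1 : ρ ≠ 1) :
    analyticOrderNatAt riemannXi ρ = analyticOrderNatAt riemannZeta ρ := by
  have hρ0 : ρ ≠ 0 := by
    rintro rfl
    simp at h0
  have he : riemannXi =ᶠ[𝓝 ρ] (fun s => s * (1 - s) * Gammaℝ s) * riemannZeta := by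
    filter_upwards [(isOpen_lt continuous_const continuous_re).mem_nhds h0,
      isOpen_ne.mem_nhds h1] with s hs hs1 using riemannXi_eq hs hs1
  have hA : AnalyticAt ℂ (fun s => s * (1 - s) * Gammaℝ s) ρ :=
    AnalyticAt.mul (by fun_prop) (analyticAt_Gammaℝ h0)
  rw [analyticOrderNatAt, analyticOrderNatAt, analyticOrderAt_congr he,
    analyticOrderAt_mul hA (analyticOn_riemannZeta ρ h1), hA.analyticOrderAt_eq_zero.2, zero_add]
  exact mul_ne_zero (mul_ne_zero hρ0 (sub_ne_zero.2 h1.symm)) (Gammaℝ_ne_zero_of_re_pos h0)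

/-! ### Growth of the xi function -/

/-- A Mellin transform is bounded on vertical strips of absolute convergence. -/
theorem norm_mellin_le {f : ℝ → ℂ} {a b : ℝ} {s : ℂ} (ha : MellinConvergent f a)
    (hb : MellinConvergent f b) (has : a ≤ s.re) (hsb : s.re ≤ b) :
    ‖mellin f s‖ ≤ (∫ x in Ioi (0 : ℝ), ‖(x : ℂ) ^ ((a : ℂ) - 1) • f x‖) +
      ∫ x in Ioi (0 : ℝ), ‖(x : ℂ) ^ ((b : ℂ) - 1) • f x‖ := by
  rw [mellin, ← MeasureTheory.integral_add ha.norm hb.norm]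
  refine MeasureTheory.norm_integral_le_of_norm_le (ha.norm.add hb.norm) ?_
  refine (MeasureTheory.ae_restrict_iff' measurableSet_Ioi).2 (.of_forall fun x hx => ?_)
  have hx' : (0 : ℝ) < x := hx
  simp only [norm_smul, norm_cpow_eq_rpow_re_of_pos hx', sub_re, ofReal_re, one_re]
  rw [← add_mul]
  gcongr
  -- `x^(σ-1)` is at most `x^(b-1)` for `x ≥ 1` and at most `x^(a-1)` for `x ≤ 1`.
  rcases le_total 1 x with h | h
  · have := Real.rpow_le_rpow_of_exponent_le h (by linarith : s.re - 1 ≤ b - 1)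
    have := Real.rpow_nonneg hx'.le (a - 1)
    linarith
  · have := Real.rpow_le_rpow_of_exponent_ge hx' h (by linarith : a - 1 ≤ s.re - 1)
    have := Real.rpow_nonneg hx'.le (b - 1)
    linarith

/-- `Λ₀(s)` is half the Mellin transform at `s/2` of a function whose transform converges
everywhere. This covers the strip around the critical one, where the Dirichlet series gives nothing.
-/
theorem exists_norm_completedRiemannZeta₀_le (a b : ℝ) :
    ∃ K, 0 ≤ K ∧ ∀ s : ℂ, a ≤ s.re → s.re ≤ b → ‖completedRiemannZeta₀ s‖ ≤ K := by
  set P := HurwitzZeta.hurwitzEvenFEPair 0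
  have hconv : ∀ s : ℂ, MellinConvergent P.f_modif s := fun s =>
    (P.isStrongFEPair_toStrongFEPair.hasMellin s).1
  refine ⟨((∫ x in Ioi (0 : ℝ), ‖(x : ℂ) ^ (((a / 2 : ℝ) : ℂ) - 1) • P.f_modif x‖) +
      ∫ x in Ioi (0 : ℝ), ‖(x : ℂ) ^ (((b / 2 : ℝ) : ℂ) - 1) • P.f_modif x‖) / 2, ?_,
    fun s has hsb => ?_⟩
  · have h1 : ∀ c : ℝ, 0 ≤ ∫ x in Ioi (0 : ℝ), ‖(x : ℂ) ^ (((c / 2 : ℝ) : ℂ) - 1) • P.f_modif x‖ :=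
      fun c => MeasureTheory.integral_nonneg fun x => norm_nonneg _
    have := h1 a
    have := h1 b
    positivity
  · have h := norm_mellin_le (hconv (a / 2 : ℝ)) (hconv (b / 2 : ℝ)) (s := s / 2)
      (by simp; linarith) (by simp; linarith)
    have e : completedRiemannZeta₀ s = mellin P.f_modif (s / 2) / 2 := rfl
    rw [e, norm_div, Complex.norm_ofNat]
    gcongr

theorem norm_riemannZeta_le {s : ℂ} (hs : 2 ≤ s.re) :
    ‖riemannZeta s‖ ≤ ∑' n : ℕ, 1 / ((n : ℝ) + 1) ^ 2 := by
  have hsum : Summable fun n : ℕ => 1 / ((n : ℝ) + 1) ^ 2 := by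
    have := (summable_nat_add_iff 1).2 (Real.summable_one_div_nat_pow.2 one_lt_two)
    simpa using this
  rw [zeta_eq_tsum_one_div_nat_add_one_cpow (by linarith)]
  refine tsum_of_norm_bounded hsum.hasSum fun n => ?_
  have hn : (1 : ℝ) ≤ n + 1 := by
    have : (0 : ℝ) ≤ n := Nat.cast_nonneg n
    linarith
  have e : ((n : ℂ) + 1) = ((n + 1 : ℝ) : ℂ) := by push_cast; rfl
  rw [norm_div, norm_one, e, norm_cpow_eq_rpow_re_of_pos (by linarith)]
  refine one_div_le_one_div_of_le (by positivity) ?_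
  rw [← Real.rpow_two]
  exact Real.rpow_le_rpow_of_exponent_le hn hs

theorem norm_Gammaℝ_le {s : ℂ} {n : ℕ} (hs : 2 ≤ s.re) (hn : s.re / 2 ≤ n + 1) :
    ‖Gammaℝ s‖ ≤ n.factorial := by
  have h2 : (s / 2).re = s.re / 2 := by simp
  have h3 := (norm_Gamma_le (s := s / 2) (by rw [h2]; linarith)).trans
    (Real.Gamma_le_factorial (n := n) (by rw [h2]; linarith) (by rwa [h2]))
  rw [Gammaℝ_def, norm_mul, norm_cpow_eq_rpow_re_of_pos Real.pi_pos]
  have h4 : π ^ (-s / 2).re ≤ 1 := by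
    refine Real.rpow_le_one_of_one_le_of_nonpos (by linarith [Real.pi_gt_three]) ?_
    simp
    linarith
  calc _ ≤ 1 * (n.factorial : ℝ) := by gcongr
    _ = _ := one_mul _

/-- `riemannXi` has order at most one. -/
theorem exists_norm_riemannXi_le : ∃ A : ℝ, 0 < A ∧ ∀ n : ℕ, 1 ≤ n → ∀ s : ℂ, ‖s‖ ≤ n →
    ‖riemannXi s‖ ≤ Real.exp (A + (n + 2) * Real.log n) := by
  obtain ⟨K, hK0, hK⟩ := exists_norm_completedRiemannZeta₀_le (-1) 2
  set B : ℝ := ∑' n : ℕ, 1 / ((n : ℝ) + 1) ^ 2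
  have hB : 0 ≤ B := tsum_nonneg fun n => by positivity
  -- The range extends to `n + 1` so that the bound also applies to `1 - s` when `|s| ≤ n` and `Re s
  -- ≤ -1`, the functional equation then covering the left side.
  have hright : ∀ n : ℕ, 1 ≤ n → ∀ s : ℂ, 2 ≤ s.re → s.re ≤ n + 1 →
      ‖completedRiemannZeta₀ s‖ ≤ (B + 2) * Real.exp (n * Real.log n) := by
    intro n hn s h2 hsn
    have hn0 : (1 : ℝ) ≤ n := by exact_mod_cast hn
    have hs0 : s ≠ 0 := by
      rintro rfl
      norm_num at h2
    have h1 : 1 ≤ ‖s‖ := by linarith [re_le_norm s]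
    have h1' : 1 ≤ ‖1 - s‖ := by
      have := re_le_norm (s - 1)
      rw [norm_sub_rev]
      simp at this
      linarith
    have e : completedRiemannZeta₀ s = Gammaℝ s * riemannZeta s + 1 / s + 1 / (1 - s) := by
      rw [riemannZeta_def_of_ne_zero hs0, mul_div_cancel₀ _
        (Gammaℝ_ne_zero_of_re_pos (by linarith)), completedRiemannZeta_eq]
      ring
    have hexp : 1 ≤ Real.exp (n * Real.log n) :=
      Real.one_le_exp (mul_nonneg (by linarith) (Real.log_nonneg hn0))
    have hG := (norm_Gammaℝ_le (n := n) h2 (by linarith)).trans (factorial_le_exp_mul_log hn)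
    have hi : ‖1 / s‖ ≤ 1 := by
      rw [norm_div, norm_one]
      exact div_le_one_of_le₀ h1 (norm_nonneg _)
    have hi' : ‖1 / (1 - s)‖ ≤ 1 := by
      rw [norm_div, norm_one]
      exact div_le_one_of_le₀ h1' (norm_nonneg _)
    calc ‖completedRiemannZeta₀ s‖ ≤ ‖Gammaℝ s‖ * ‖riemannZeta s‖ + ‖1 / s‖ + ‖1 / (1 - s)‖ := by
          rw [e, ← norm_mul]
          exact norm_add₃_le
      _ ≤ Real.exp (n * Real.log n) * B + 1 + 1 := by
          gcongr
          exact norm_riemannZeta_le h2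
      _ ≤ _ := by linarith
  refine ⟨Real.log (2 * (K + B + 2) + 1), Real.log_pos (by linarith), fun n hn s hsn => ?_⟩
  have hn0 : (1 : ℝ) ≤ n := by exact_mod_cast hn
  have hexp : 1 ≤ Real.exp (n * Real.log n) :=
    Real.one_le_exp (mul_nonneg (by linarith) (Real.log_nonneg hn0))
  set E := Real.exp (n * Real.log n)
  have hΛ : ‖completedRiemannZeta₀ s‖ ≤ (K + B + 2) * E := by
    have hre := abs_le.1 ((abs_re_le_norm s).trans hsn)
    have hKE : 0 ≤ K * E := by positivity
    have hBE : 0 ≤ (B + 2) * E := by positivity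
    rcases le_total 2 s.re with h2 | h2
    · linarith [hright n hn s h2 (by linarith)]
    rcases le_total (-1) s.re with h1 | h1
    · have h3 := hK s h1 h2
      nlinarith
    · have h3 := hright n hn (1 - s) (by simp; linarith) (by simp; linarith)
      rw [completedRiemannZeta₀_one_sub] at h3
      linarith
  -- The extra `2 log n` in the exponent absorbs `|s (1 - s)| ≤ 2n²`, and the `+ 1` in the constant
  -- absorbs the final `-1` of `riemannXi`.
  have e : Real.exp (Real.log (2 * (K + B + 2) + 1) + (n + 2) * Real.log n)
      = (2 * (K + B + 2) + 1) * (E * n ^ 2) := by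
    rw [Real.exp_add, Real.exp_log (by linarith), add_mul (n : ℝ), Real.exp_add, mul_comm 2 (Real.log n),
      Real.exp_mul (Real.log n), Real.exp_log (by linarith), Real.rpow_two]
  rw [e]
  have h1s : ‖1 - s‖ ≤ 2 * n := by
    have := norm_sub_le 1 s
    rw [norm_one] at this
    linarith
  have hn2 : 1 ≤ E * (n : ℝ) ^ 2 := one_le_mul_of_one_le_of_one_le hexp (one_le_pow₀ hn0)
  calc ‖riemannXi s‖ ≤ ‖s‖ * ‖1 - s‖ * ‖completedRiemannZeta₀ s‖ + 1 := by
        rw [riemannXi, ← norm_mul, ← norm_mul]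
        simpa using norm_sub_le (s * (1 - s) * completedRiemannZeta₀ s) 1
    _ ≤ n * (2 * n) * ((K + B + 2) * E) + 1 := by gcongr
    _ ≤ _ := by linarith

/-! ### The sum over the zeros -/

theorem finite_nontrivialZetaZeros_norm_le (r : ℝ) :
    {ρ : nontrivialZetaZeros | ‖(ρ : ℂ)‖ ≤ r}.Finite := by
  have h := ((isCompact_closedBall (0 : ℂ) r).inter_riemannZetaZeros_finite)
  refine (h.preimage (f := ((↑) : nontrivialZetaZeros → ℂ))
    Subtype.val_injective.injOn).subset fun ρ hρ => ⟨?_, ρ.2.1⟩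
  simpa using hρ

/-- The nontrivial zeros of absolute value at most `r`. -/
def zerosNormLe (r : ℝ) : Finset nontrivialZetaZeros :=
  (finite_nontrivialZetaZeros_norm_le r).toFinset

theorem mem_zerosNormLe {r : ℝ} {ρ : nontrivialZetaZeros} :
    ρ ∈ zerosNormLe r ↔ ‖(ρ : ℂ)‖ ≤ r := by
  simp [zerosNormLe]

theorem monotone_zerosNormLe : Monotone fun n : ℕ => zerosNormLe n := fun m n h ρ hρ => by
  rw [mem_zerosNormLe] at hρ ⊢
  exact hρ.trans (by exact_mod_cast h)

theorem tendsto_zerosNormLe : Tendsto (fun n : ℕ => zerosNormLe n) atTop atTop :=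
  tendsto_atTop_finset_of_monotone monotone_zerosNormLe fun ρ => by
    obtain ⟨n, hn⟩ := exists_nat_ge ‖(ρ : ℂ)‖
    exact ⟨n, mem_zerosNormLe.2 hn⟩

/-- The second logarithmic derivative of `riemannXi` is minus the sum of `1 / (s - ρ)²` over the
nontrivial zeros, summed by increasing absolute value. -/
theorem tendsto_sum_zerosNormLe {s : ℂ} (hs : riemannXi s ≠ 0) :
    Tendsto (fun n : ℕ => ∑ ρ ∈ zerosNormLe n,
      (analyticOrderNatAt riemannZeta (ρ : ℂ) : ℂ) / (s - ρ) ^ 2) atTop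
      (𝓝 (-deriv (logDeriv riemannXi) s)) := by
  obtain ⟨A, hA0, hA⟩ := exists_norm_riemannXi_le
  -- This is `64 M / n²` with `M = A + (2n + 2) log (2n)`, the growth exponent on the circle of
  -- radius `2n`.
  have hlim : Tendsto (fun n : ℕ => 64 * (A * (1 / (n : ℝ)) * (1 / n)
      + (2 + 2 * (1 / (n : ℝ))) * (Real.log (2 * n) / n))) atTop (𝓝 0) := by
    have h1 : Tendsto (fun n : ℕ => 1 / (n : ℝ)) atTop (𝓝 0) := tendsto_one_div_atTop_nhds_zero_nat
    have h2 := tendsto_log_div_self_nat (by norm_num : (0 : ℝ) < 2)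
    simpa using ((((h1.const_mul A).mul h1).add (((h1.const_mul 2).const_add 2).mul h2)).const_mul 64)
  rw [tendsto_iff_norm_sub_tendsto_zero]
  refine squeeze_zero' (.of_forall fun _ => norm_nonneg _) ?_ hlim
  filter_upwards [eventually_ge_atTop 1,
    (tendsto_natCast_atTop_atTop (R := ℝ)).eventually_gt_atTop (4 * ‖s‖)] with n hn hns
  have hn0 : (1 : ℝ) ≤ n := by exact_mod_cast hn
  have hlog : 0 ≤ Real.log (2 * n : ℕ) := Real.log_nonneg (by push_cast; linarith)
  have key := norm_deriv_logDeriv_add_sum_le differentiable_riemannXi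
    (by simp [riemannXi_zero]) (R := n) (M := A + ((2 * n : ℕ) + 2) * Real.log (2 * n : ℕ))
    (by linarith) (by positivity)
    (fun w hw => by
      rw [riemannXi_zero, norm_neg, norm_one, mul_one]
      exact hA (2 * n) (by lia) w (by push_cast; exact hw.le))
    (S := (zerosNormLe n).map (Function.Embedding.subtype _))
    (fun ρ => by
      rw [riemannXi_eq_zero_iff]
      simp [mem_zerosNormLe, and_comm])
    (z := s) (by linarith) hs
  rw [Finset.sum_map] at key
  rw [sub_neg_eq_add, add_comm]
  have e : ∀ ρ : nontrivialZetaZeros, analyticOrderNatAt riemannXi (ρ : ℂ)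
      = analyticOrderNatAt riemannZeta (ρ : ℂ) := fun ρ =>
    analyticOrderNatAt_riemannXi ρ.2.2.1 fun h => by
      have := ρ.2.2.2
      simp [h] at this
  simp only [Function.Embedding.subtype_apply, e] at key
  refine key.trans (le_of_eq ?_)
  push_cast
  field_simp

theorem RiemannHypothesis.re_eq {ρ : ℂ} (hRH : RiemannHypothesis) (hρ : ρ ∈ nontrivialZetaZeros) :
    ρ.re = 1 / 2 := by
  refine hRH ρ hρ.1 ?_ ?_
  · rintro ⟨n, rfl⟩
    have h := hρ.2.1
    have hn : (0 : ℝ) ≤ n := Nat.cast_nonneg n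
    simp at h
    linarith
  · rintro rfl
    simpa using hρ.2.2

theorem criticalLine_ne_one (t : ℝ) : (1 / 2 + I * t : ℂ) ≠ 1 := fun h => by
  have := congrArg re h
  norm_num at this

theorem criticalLine_ne_zero (t : ℝ) : (1 / 2 + I * t : ℂ) ≠ 0 := fun h => by
  have := congrArg re h
  norm_num at this

theorem riemannXi_criticalLine_ne_zero {t : ℝ} (ht : riemannZeta (1 / 2 + I * t) ≠ 0) :
    riemannXi (1 / 2 + I * t) ≠ 0 := fun h => ht (riemannXi_eq_zero_iff.1 h).1

/-- Under the Riemann Hypothesis, `∑ (t - γ)⁻²` converges to the second logarithmic derivative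
of `riemannXi`. -/
theorem hasSum_zeroTerm (hRH : RiemannHypothesis) {t : ℝ}
    (ht : riemannZeta (1 / 2 + I * t) ≠ 0) :
    HasSum (zeroTerm t) (deriv (logDeriv riemannXi) (1 / 2 + I * t)).re := by
  have hterm : ∀ ρ : nontrivialZetaZeros,
      (analyticOrderNatAt riemannZeta (ρ : ℂ) : ℂ) / ((1 / 2 + I * t) - ρ) ^ 2
        = ((-zeroTerm t ρ : ℝ) : ℂ) := by
    intro ρ
    -- RH enters here: the difference is purely imaginary, so its square is `-(t - γ)²`.
    have h1 : (1 / 2 + I * t) - (ρ : ℂ) = I * ((t - (ρ : ℂ).im : ℝ) : ℂ) := by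
      apply Complex.ext
      · simp [hRH.re_eq ρ.2]
      · simp
    rw [h1, mul_pow, I_sq, zeroTerm, neg_one_mul, div_neg]
    push_cast
    ring
  have hlim : Tendsto (fun n : ℕ => ∑ ρ ∈ zerosNormLe n, zeroTerm t ρ) atTop
      (𝓝 (deriv (logDeriv riemannXi) (1 / 2 + I * t)).re) := by
    have h := ((continuous_re.tendsto _).comp
      (tendsto_sum_zerosNormLe (riemannXi_criticalLine_ne_zero ht))).neg
    simp only [neg_re, neg_neg] at h
    refine h.congr fun n => ?_
    simp only [Function.comp_apply, hterm]
    rw [← ofReal_sum, ofReal_re, Finset.sum_neg_distrib, neg_neg]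
  -- Nonnegativity upgrades convergence along growing discs to unconditional summability with the
  -- same sum.
  have hnn : ∀ ρ, 0 ≤ zeroTerm t ρ := fun ρ => by
    unfold zeroTerm
    positivity
  have hmono : Monotone fun n : ℕ => ∑ ρ ∈ zerosNormLe n, zeroTerm t ρ := fun m n h =>
    Finset.sum_le_sum_of_subset_of_nonneg (monotone_zerosNormLe h) fun ρ _ _ => hnn ρ
  have hsum : Summable (zeroTerm t) := by
    refine summable_of_sum_le (c := (deriv (logDeriv riemannXi) (1 / 2 + I * t)).re) hnn fun u => ?_
    obtain ⟨n, hn⟩ := (tendsto_zerosNormLe.eventually_ge_atTop u).exists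
    exact (Finset.sum_le_sum_of_subset_of_nonneg hn fun ρ _ _ => hnn ρ).trans
      (hmono.ge_of_tendsto hlim n)
  rw [← tendsto_nhds_unique (hsum.hasSum.comp tendsto_zerosNormLe) hlim]
  exact hsum.hasSum

/-! ### Derivatives of Hardy's function -/

theorem hasDerivAt_criticalLine (t : ℝ) : HasDerivAt (fun u : ℝ => (1 / 2 + I * u : ℂ)) I t := by
  simpa using ((hasDerivAt_id t).ofReal_comp.const_mul I).const_add (1 / 2 : ℂ)

theorem hasDerivAt_quarterLine (t : ℝ) :
    HasDerivAt (fun u : ℝ => (1 / 4 + I * u / 2 : ℂ)) (I / 2) t := by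
  simpa using (((hasDerivAt_id t).ofReal_comp.const_mul I).div_const 2).const_add (1 / 4 : ℂ)

theorem hasDerivAt_siegelTheta (t : ℝ) :
    HasDerivAt siegelTheta ((digamma (1 / 4 + I * t / 2)).re / 2 - Real.log π / 2) t := by
  have hc : Continuous fun u : ℝ => (digamma (1 / 4 + I * u / 2)).re / 2 :=
    (continuous_re.comp continuous_digamma_quarterLine).div_const 2
  refine (((hc.integral_hasStrictDerivAt 0 t).hasDerivAt).sub
    (((hasDerivAt_id t).div_const 2).mul_const (Real.log π))).congr_deriv ?_
  ring

theorem ofReal_hardyZ (t : ℝ) :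
    (hardyZ t : ℂ) = exp (I * siegelTheta t) * riemannZeta (1 / 2 + I * t) := by
  rw [riemannZeta_eq_exp_mul_hardyZ, ← mul_assoc, ← exp_add, add_neg_cancel, exp_zero, one_mul]

theorem hasDerivAt_ofReal_hardyZ (t : ℝ) :
    HasDerivAt (fun u : ℝ => (hardyZ u : ℂ)) (exp (I * siegelTheta t) *
      (I * (((digamma (1 / 4 + I * t / 2)).re / 2 - Real.log π / 2 : ℝ) : ℂ)
        * riemannZeta (1 / 2 + I * t) + I * deriv riemannZeta (1 / 2 + I * t))) t := by
  have h1 := ((hasDerivAt_siegelTheta t).ofReal_comp.const_mul I).cexp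
  have h2 : HasDerivAt (fun u : ℝ => riemannZeta (1 / 2 + I * u))
      (deriv riemannZeta (1 / 2 + I * t) * I) t :=
    ((differentiableAt_riemannZeta (criticalLine_ne_one t)).hasDerivAt).comp t
      (hasDerivAt_criticalLine t)
  rw [funext ofReal_hardyZ]
  refine (h1.mul h2).congr_deriv ?_
  ring

theorem differentiableAt_hardyZ (t : ℝ) : DifferentiableAt ℝ hardyZ t := by
  have := (reCLM.hasFDerivAt.comp_hasDerivAt t (hasDerivAt_ofReal_hardyZ t)).differentiableAt
  exact this

theorem hardyZ_ne_zero {t : ℝ} (ht : riemannZeta (1 / 2 + I * t) ≠ 0) : hardyZ t ≠ 0 := fun h =>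
  ht (by rw [riemannZeta_eq_exp_mul_hardyZ, h, ofReal_zero, mul_zero])

theorem ofReal_deriv_hardyZ_div {t : ℝ} (ht : riemannZeta (1 / 2 + I * t) ≠ 0) :
    ((deriv hardyZ t / hardyZ t : ℝ) : ℂ) =
      I * (((digamma (1 / 4 + I * t / 2)).re / 2 - Real.log π / 2 : ℝ) : ℂ)
        + I * logDeriv riemannZeta (1 / 2 + I * t) := by
  have h := (differentiableAt_hardyZ t).hasDerivAt.ofReal_comp.unique (hasDerivAt_ofReal_hardyZ t)
  rw [ofReal_div, h, ofReal_hardyZ, logDeriv_apply]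
  rw [mul_div_mul_left _ _ (exp_ne_zero _), add_div, mul_div_cancel_right₀ _ ht,
    mul_div_assoc I (deriv _ _)]

theorem logDeriv_Gammaℝ {s : ℂ} (hs : 0 < s.re) :
    logDeriv Gammaℝ s = -(Real.log π / 2 : ℝ) + digamma (s / 2) / 2 := by
  have hπ : (π : ℂ) ≠ 0 := by exact_mod_cast Real.pi_ne_zero
  have hs2 : 0 < (s / 2).re := by simpa using hs
  have hd : HasDerivAt (fun s : ℂ => s / 2) (1 / 2) s := (hasDerivAt_id s).div_const 2
  have h1 : HasDerivAt (fun s : ℂ => (π : ℂ) ^ (-s / 2))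
      ((π : ℂ) ^ (-s / 2) * Complex.log π * (-1 / 2)) s :=
    ((hasDerivAt_id s).neg.div_const 2).const_cpow (Or.inl hπ)
  have h2 : HasDerivAt (fun s : ℂ => Gamma (s / 2)) (deriv Gamma (s / 2) * (1 / 2)) s :=
    ((analyticAt_Gamma hs2).differentiableAt.hasDerivAt).comp s hd
  have hp : (π : ℂ) ^ (-s / 2) ≠ 0 := by simp [cpow_eq_zero_iff, hπ]
  have hG := Gamma_ne_zero_of_re_pos hs2
  have e : Gammaℝ = fun s => (π : ℂ) ^ (-s / 2) * Gamma (s / 2) := rfl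
  rw [e, logDeriv_mul s hp hG h1.differentiableAt h2.differentiableAt, logDeriv_apply,
    logDeriv_apply, h1.deriv, h2.deriv, digamma_def, logDeriv_apply]
  push_cast
  rw [ofReal_log Real.pi_pos.le]
  field_simp

theorem logDeriv_riemannXi {s : ℂ} (h0 : 0 < s.re) (h1 : s ≠ 1) (hζ : riemannZeta s ≠ 0) :
    logDeriv riemannXi s = 1 / s - 1 / (1 - s) + logDeriv Gammaℝ s + logDeriv riemannZeta s := by
  have hs0 : s ≠ 0 := by
    rintro rfl
    simp at h0
  have hs1 : 1 - s ≠ 0 := sub_ne_zero.2 h1.symm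
  have he : riemannXi =ᶠ[𝓝 s] fun s => s * (1 - s) * Gammaℝ s * riemannZeta s := by
    filter_upwards [(isOpen_lt continuous_const continuous_re).mem_nhds h0,
      isOpen_ne.mem_nhds h1] with s hs hs1 using riemannXi_eq hs hs1
  have hG := Gammaℝ_ne_zero_of_re_pos h0
  have hGd := (analyticAt_Gammaℝ h0).differentiableAt
  have hd : HasDerivAt (fun s : ℂ => 1 - s) (-1) s := (hasDerivAt_id s).const_sub 1
  rw [(logDeriv_congr_nhds he).eq_of_nhds,
    logDeriv_mul (f := fun s => s * (1 - s) * Gammaℝ s) (g := riemannZeta) s (mul_ne_zero (mul_ne_zero hs0 hs1) hG) hζ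
    (by fun_prop) (differentiableAt_riemannZeta h1),
    logDeriv_mul (f := fun s => s * (1 - s)) (g := Gammaℝ) s (mul_ne_zero hs0 hs1) hG (by fun_prop) hGd,
    logDeriv_mul (f := fun s => s) (g := fun s => 1 - s) s hs0 hs1 (by fun_prop) (by fun_prop),
    logDeriv_id', logDeriv_apply (fun s => 1 - s), hd.deriv]
  ring

/-- `Z'/Z = iϑ' + i ζ'/ζ` is real and `iϑ'` is imaginary, so only `Re (i ζ'/ζ)` survives. Replacing
`ζ'/ζ` by `ξ'/ξ` brings in the rational terms and `ψ/2`, whose contribution to the real part is `Im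
ψ / 2`. -/
theorem deriv_hardyZ_div_eq {t : ℝ} (ht : riemannZeta (1 / 2 + I * t) ≠ 0) :
    deriv hardyZ t / hardyZ t = (I * logDeriv riemannXi (1 / 2 + I * t)
      - I * (1 / (1 / 2 + I * t) - 1 / (1 - (1 / 2 + I * t)))).re
      + (digamma (1 / 4 + I * t / 2)).im / 2 := by
  have h1 := ofReal_deriv_hardyZ_div ht
  have h2 := logDeriv_riemannXi (by simp) (criticalLine_ne_one t) ht
  rw [logDeriv_Gammaℝ (by simp), show (1 / 2 + I * t : ℂ) / 2 = 1 / 4 + I * t / 2 by ring] at h2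
  have h3 := congrArg re h1
  rw [ofReal_re] at h3
  have h4 : I * logDeriv riemannXi (1 / 2 + I * t)
      - I * (1 / (1 / 2 + I * t) - 1 / (1 - (1 / 2 + I * t)))
      = I * (-(Real.log π / 2 : ℝ) + digamma (1 / 4 + I * t / 2) / 2)
        + I * logDeriv riemannZeta (1 / 2 + I * t) := by
    rw [h2]
    ring
  rw [h3, h4]
  simp

theorem hasDerivAt_deriv_hardyZ_div {t : ℝ} (ht : riemannZeta (1 / 2 + I * t) ≠ 0) :
    HasDerivAt (fun u : ℝ => deriv hardyZ u / hardyZ u)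
      ((-deriv (logDeriv riemannXi) (1 / 2 + I * t)
        - (1 / (1 / 2 + I * t) ^ 2 + 1 / (1 - (1 / 2 + I * t)) ^ 2)).re
        + (deriv digamma (1 / 4 + I * t / 2)).re / 4) t := by
  have hξ := riemannXi_criticalLine_ne_zero ht
  have hs0 := criticalLine_ne_zero t
  have hs1 : 1 - (1 / 2 + I * t : ℂ) ≠ 0 := sub_ne_zero.2 (criticalLine_ne_one t).symm
  have hξd : DifferentiableAt ℂ (logDeriv riemannXi) (1 / 2 + I * t) :=
    ((differentiable_riemannXi.analyticAt _).deriv.div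
      (differentiable_riemannXi.analyticAt _) hξ).differentiableAt
  have hl := hasDerivAt_criticalLine t
  have h1 : HasDerivAt (fun u : ℝ => logDeriv riemannXi (1 / 2 + I * u))
      (deriv (logDeriv riemannXi) (1 / 2 + I * t) * I) t := hξd.hasDerivAt.comp t hl
  have h2 := (hl.fun_inv hs0).sub ((hl.const_sub 1).fun_inv hs1)
  have h3 := reCLM.hasFDerivAt.comp_hasDerivAt t ((h1.const_mul I).sub (h2.const_mul I))
  have h4 : HasDerivAt (fun u : ℝ => digamma (1 / 4 + I * u / 2))
      (deriv digamma (1 / 4 + I * t / 2) * (I / 2)) t :=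
    ((analyticAt_digamma (by simp)).differentiableAt.hasDerivAt).comp t (hasDerivAt_quarterLine t)
  have h5 := (imCLM.hasFDerivAt.comp_hasDerivAt t h4).div_const 2
  refine ((h3.add h5).congr_of_eventuallyEq ?_).congr_deriv ?_
  -- The formula for `Z'/Z` requires `ζ ≠ 0`; continuity supplies this near `t`, which is enough to
  -- differentiate it.
  · have hc : ContinuousAt (fun u : ℝ => riemannZeta (1 / 2 + I * u)) t :=
      (((differentiableAt_riemannZeta (criticalLine_ne_one t)).hasDerivAt).comp t hl).continuousAt
    filter_upwards [hc.eventually_ne ht] with u hu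
    rw [deriv_hardyZ_div_eq hu]
    simp [one_div]
  · have e : I * (deriv (logDeriv riemannXi) (1 / 2 + I * t) * I)
        - I * (-I / (1 / 2 + I * t) ^ 2 - -(-I) / (1 - (1 / 2 + I * t)) ^ 2)
        = -deriv (logDeriv riemannXi) (1 / 2 + I * t)
        - (1 / (1 / 2 + I * t) ^ 2 + 1 / (1 - (1 / 2 + I * t)) ^ 2) := by
      linear_combination (deriv (logDeriv riemannXi) (1 / 2 + I * t)
        + 1 / (1 / 2 + I * t) ^ 2 + 1 / (1 - (1 / 2 + I * t)) ^ 2) * I_sq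
    rw [← e]
    simp only [reCLM_apply, imCLM_apply]
    congr 1
    simp [mul_im]
    ring

/-- Near `t`, `Z' = (Z'/Z) · Z` is a product of functions differentiable at `t`, so no formula for
`Z''` is needed. -/
theorem differentiableAt_deriv_hardyZ {t : ℝ} (ht : riemannZeta (1 / 2 + I * t) ≠ 0) :
    DifferentiableAt ℝ (deriv hardyZ) t := by
  have h := ((hasDerivAt_deriv_hardyZ_div ht).differentiableAt).mul (differentiableAt_hardyZ t)
  refine h.congr_of_eventuallyEq ?_
  filter_upwards [(differentiableAt_hardyZ t).continuousAt.eventually_ne (hardyZ_ne_zero ht)]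
    with u hu
  simp [div_mul_cancel₀ _ hu]

/-! ### The error term -/

theorem abs_tsum_zeroTerm_add_deriv_le (hRH : RiemannHypothesis) {t : ℝ} (h2 : 2 ≤ t)
    (ht : riemannZeta (1 / 2 + I * t) ≠ 0) :
    |(∑' ρ, zeroTerm t ρ) - (-deriv (fun u : ℝ => deriv hardyZ u / hardyZ u) t)| ≤ 6 / t := by
  have ht0 : 0 < t := by linarith
  rw [(hasSum_zeroTerm hRH ht).tsum_eq, (hasDerivAt_deriv_hardyZ_div ht).deriv]
  -- The trigamma bound needs imaginary part `t / 2 ≥ 1`, hence `t ≥ 2`. It contributes `4/t`, and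
  -- the two rational terms together at most `1/t`.
  have hψ := norm_deriv_digamma_le (s := 1 / 4 + I * t / 2) (by simp) (by simp; linarith)
  have him : (1 / 4 + I * t / 2 : ℂ).im = t / 2 := by simp
  rw [him] at hψ
  have hsq : ∀ w : ℂ, |w.im| = t → ‖1 / w ^ 2‖ ≤ 1 / t ^ 2 := by
    intro w hw
    rw [norm_div, norm_one, norm_pow]
    have := abs_im_le_norm w
    rw [hw] at this
    gcongr
  have ha := hsq (1 / 2 + I * t) (by simp [abs_of_pos ht0])
  have hb := hsq (1 - (1 / 2 + I * t)) (by simp [abs_of_pos ht0])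
  have e : (deriv (logDeriv riemannXi) (1 / 2 + I * t)).re
      - -((-deriv (logDeriv riemannXi) (1 / 2 + I * t)
        - (1 / (1 / 2 + I * t) ^ 2 + 1 / (1 - (1 / 2 + I * t)) ^ 2)).re
        + (deriv digamma (1 / 4 + I * t / 2)).re / 4)
      = (-(1 / (1 / 2 + I * t) ^ 2 + 1 / (1 - (1 / 2 + I * t)) ^ 2)
        + deriv digamma (1 / 4 + I * t / 2) / 4 : ℂ).re := by
    simp only [add_re, sub_re, neg_re]
    rw [show (4 : ℂ) = ((4 : ℝ) : ℂ) by norm_num, div_ofReal_re]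
    ring
  rw [e]
  have ht2 : 1 / t ^ 2 ≤ 1 / (2 * t) := one_div_le_one_div_of_le (by positivity) (by nlinarith)
  calc _ ≤ ‖-(1 / (1 / 2 + I * t) ^ 2 + 1 / (1 - (1 / 2 + I * t)) ^ 2)
        + deriv digamma (1 / 4 + I * t / 2) / 4‖ := abs_re_le_norm _
    _ ≤ (1 / t ^ 2 + 1 / t ^ 2) + 8 / (t / 2) / 4 := by
        refine (norm_add_le _ _).trans (add_le_add ?_ ?_)
        · rw [norm_neg]
          exact (norm_add_le _ _).trans (add_le_add ha hb)
        · rw [norm_div, Complex.norm_ofNat]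
          gcongr
    _ ≤ (1 / (2 * t) + 1 / (2 * t)) + 8 / (t / 2) / 4 := by gcongr
    _ = 5 / t := by
        field_simp
        norm_num
    _ ≤ 6 / t := by
        gcongr
        norm_num

end

theorem mainTheorem1 (hRH : RiemannHypothesis) :
    ∃ C T : ℝ, 0 < C ∧ 0 < T ∧
      ∀ t : ℝ, T ≤ t → riemannZeta (1 / 2 + Complex.I * t) ≠ 0 →
        Summable (zeroTerm t) ∧
        DifferentiableAt ℝ hardyZ t ∧
        DifferentiableAt ℝ (deriv hardyZ) t ∧
        |(∑' ρ, zeroTerm t ρ) -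
            (-deriv (fun u : ℝ => deriv hardyZ u / hardyZ u) t)| ≤ C / t ∧
        |(∑' ρ, zeroTerm t ρ) -
            ((deriv hardyZ t / hardyZ t) ^ 2 - deriv (deriv hardyZ) t / hardyZ t)| ≤ C / t := by
  refine ⟨6, 2, by norm_num, by norm_num, fun t h2 ht => ?_⟩
  have h := abs_tsum_zeroTerm_add_deriv_le hRH h2 ht
  have hZ := hardyZ_ne_zero ht
  have hd := differentiableAt_deriv_hardyZ ht
  refine ⟨(hasSum_zeroTerm hRH ht).summable, differentiableAt_hardyZ t, hd, h, ?_⟩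
  have e : (deriv hardyZ t / hardyZ t) ^ 2 - deriv (deriv hardyZ) t / hardyZ t
      = -deriv (fun u : ℝ => deriv hardyZ u / hardyZ u) t := by
    rw [deriv_fun_div hd (differentiableAt_hardyZ t) hZ]
    field_simp
    ring
  rwa [e]
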